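/- Fix a dimension $N$. For $\boldsymbol\alpha=(\alpha_1,\dots,\alpha_m)\in(0,1)^m$ with $\sum_{i=1}^m\alpha_i^N<1$ (a contraction vector), let $\mathcal D(\boldsymbol\alpha)$ be the collection of all dust-like self-similar sets in $\mathbb R^N$ with contraction ratios $\boldsymbol\alpha$, i.e. of all nonempty compact $E\subset\mathbb R^N$ for which there are orthogonal matrices $R_i$ and vectors $v_i\in\mathbb R^N$ such that, with $f_i(x)=\alpha_iR_i(x+v_i)$, one has $E=\bigcup_{i=1}^m f_i(E)$ and $f_i(E)\cap f_j(E)=\emptyset$ for $i\neq j$. Two sets $E,F\subset\mathbb R^N$ are Lipschitz equivalent, $E\sim F$, if there are a bijection $\phi:E\to F$ and a constant $C>0$ with $C^{-1}|x-y|\le|\phi(x)-\phi(y)|\le C|x-y|$ for all $x,y\in E$; and $\mathcal D(\boldsymbol\alpha)\sim\mathcal D(\boldsymbol\beta)$ means that $E\sim F$ for some $E\in\mathcal D(\boldsymbol\alpha)$ and $F\in\mathcal D(\boldsymbol\beta)$. Theorem. Let $0<\lambda<1$, let $a,b,c,d,e$ be positive integers, and let $\boldsymbol\alpha=(\lambda^a,\lambda^b,\lambda^c)$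 and $\boldsymbol\beta=(\lambda^d,\lambda^e)$ be contraction vectors. If $\mathcal D(\boldsymbol\alpha)\sim\mathcal D(\boldsymbol\beta)$, then the polynomial $x^a+x^b+x^c-1$ is reducible over $\mathbb Q$, i.e. it is a product of two non-constant polynomials in $\mathbb Q[x]$. -/

import Mathlib

namespace CantorLip

/-- The similarity `x ↦ r • R (x + v)` of `ℝ^N` with ratio `r`, orthogonal part `R` and
translation vector `v`. -/
noncomputable def simMap {N : ℕ} (r : ℝ) (R : EuclideanSpace ℝ (Fin N) ≃ₗᵢ[ℝ] EuclideanSpace ℝ (Fin N))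
    (v : EuclideanSpace ℝ (Fin N)) (x : EuclideanSpace ℝ (Fin N)) : EuclideanSpace ℝ (Fin N) :=
  r • R (x + v)

/-- `α = (α₁, …, αₘ)` is a contraction vector for `ℝ^N`: all `αᵢ` lie in `(0,1)` and
`∑ αᵢ ^ N < 1`. -/
def IsContractionVector (N : ℕ) {m : ℕ} (α : Fin m → ℝ) : Prop :=
  (∀ i, 0 < α i ∧ α i < 1) ∧ ∑ i, α i ^ N < 1

/-- `𝒟(α)`: the collection of all dust-like self-similar sets in `ℝ^N` with contraction
ratios `α`, i.e. of all nonempty compact `E` with `E = ⋃ᵢ fᵢ(E)`, the pieces `fᵢ(E)` being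
pairwise disjoint, for some similarities `fᵢ` of ratios `αᵢ`. -/
def dustLikeSets (N : ℕ) {m : ℕ} (α : Fin m → ℝ) : Set (Set (EuclideanSpace ℝ (Fin N))) :=
  {E | E.Nonempty ∧ IsCompact E ∧
    ∃ (R : Fin m → (EuclideanSpace ℝ (Fin N) ≃ₗᵢ[ℝ] EuclideanSpace ℝ (Fin N)))
      (v : Fin m → EuclideanSpace ℝ (Fin N)),
      E = ⋃ i, simMap (α i) (R i) (v i) '' E ∧
      ∀ i j, i ≠ j →
        (simMap (α i) (R i) (v i) '' E) ∩ (simMap (α j) (R j) (v j) '' E) = ∅}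

/-- Lipschitz equivalence of two subsets of `ℝ^N`: there is a bi-Lipschitz bijection of `E`
onto `F`. -/
def LipEquiv {N : ℕ} (E F : Set (EuclideanSpace ℝ (Fin N))) : Prop :=
  ∃ φ : E → F, Function.Bijective φ ∧
    ∃ C : ℝ, 0 < C ∧ ∀ x y : E,
      C⁻¹ * dist x y ≤ dist (φ x) (φ y) ∧ dist (φ x) (φ y) ≤ C * dist x y

/-- `𝒟(α) ∼ 𝒟(β)`: some member of `𝒟(α)` is Lipschitz equivalent to some member of `𝒟(β)`. -/
def DustLipEquiv (N : ℕ) {m n : ℕ} (α : Fin m → ℝ) (β : Fin n → ℝ) : Prop :=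
  ∃ E ∈ dustLikeSets N α, ∃ F ∈ dustLikeSets N β, LipEquiv E F

end CantorLip

namespace CantorLip

open Polynomial

/-! Let `x` in `(0, 1)` solve the Moran equation `∑ x ^ k i = 1`. Self-similarity shows that the
largest `lam ^ n`-separated subsets of a dust-like set have size comparable to `x ^ (-n)`
(`exists_card_mul_pow_le`, `exists_isSep_le_card_mul_pow`). A bi-Lipschitz map only shifts `n` by a
constant, so `x` is an invariant (`le_of_dist_bounds`), and the two Moran equations share a root. If
the polynomial with three powers were irreducible, it would divide `X ^ d + X ^ e - 1` over `ℚ`,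
hence over `ℤ` by Gauss's lemma. The values at `1` are `2` and `1`, a contradiction. -/

/-- Distinct points of `S` are at distance at least `r`. -/
def IsSep {X : Type*} [MetricSpace X] (r : ℝ) (S : Finset X) : Prop :=
  ∀ p ∈ S, ∀ q ∈ S, p ≠ q → r ≤ dist p q

/-- Separated subsets of a compact set have uniformly bounded cardinality. -/
theorem exists_card_le_of_isSep {X : Type*} [MetricSpace X] {E : Set X} (hE : IsCompact E)
    {r : ℝ} (hr : 0 < r) :
    ∃ K : ℕ, ∀ S : Finset X, (S : Set X) ⊆ E → IsSep r S → S.card ≤ K := by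
  classical
  obtain ⟨t, -, htf, hcov⟩ := hE.finite_cover_balls (half_pos hr)
  refine ⟨htf.toFinset.card, fun S hSE hS => ?_⟩
  have hex : ∀ p : X, ∃ z : X, p ∈ S → z ∈ t ∧ dist p z < r / 2 := by
    intro p
    by_cases hp : p ∈ S
    · obtain ⟨z, hz, hpz⟩ := Set.mem_iUnion₂.1 (hcov (hSE hp))
      exact ⟨z, fun _ => ⟨hz, hpz⟩⟩
    · exact ⟨p, fun h => absurd h hp⟩
  choose g hg using hex
  -- A ball of radius `r / 2` contains at most one point of `S`, so `g` is injective on `S`.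
  refine Finset.card_le_card_of_injOn g (fun p hp => by simpa using (hg p hp).1) ?_
  intro p hp q hq hpq
  by_contra hne
  have h1 := hS p hp q hq hne
  have h2 := (hg p hp).2
  have h3 := (hg q hq).2
  rw [← hpq] at h3
  have h4 := dist_triangle_right p q (g p)
  linarith

/-- Upper bound for the size of `lam ^ n`-separated subsets of a self-similar set. -/
theorem exists_card_mul_pow_le {X : Type*} [MetricSpace X] {m : ℕ} {E : Set X}
    (hE : IsCompact E) {lam x : ℝ} (hlam0 : 0 < lam) (hlam1 : lam < 1) (hx0 : 0 < x)
    (hx1 : x < 1) (k : Fin m → ℕ) (hk : ∀ i, 0 < k i) (hx : ∑ i, x ^ k i = 1)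
    (f : Fin m → X → X) (hf : ∀ i p q, dist (f i p) (f i q) = lam ^ k i * dist p q)
    (hcov : E ⊆ ⋃ i, f i '' E) :
    ∃ K : ℝ, ∀ n : ℕ, ∀ S : Finset X, (S : Set X) ⊆ E → IsSep (lam ^ n) S →
      S.card * x ^ n ≤ K := by
  classical
  have hinj : ∀ i, Function.Injective (f i) := by
    intro i p q hpq
    have h := hf i p q
    rw [hpq, dist_self] at h
    exact dist_eq_zero.1 ((mul_eq_zero.1 h.symm).resolve_left (pow_pos hlam0 _).ne')
  -- Any bound for all the `k i` would do: it makes `n - k i` a true difference once `n ≥ n₀`.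
  set n₀ := ∑ i, k i
  have hkn : ∀ i, k i ≤ n₀ := fun i =>
    Finset.single_le_sum (f := k) (fun _ _ => Nat.zero_le _) (Finset.mem_univ i)
  obtain ⟨K, hK⟩ := exists_card_le_of_isSep hE (pow_pos hlam0 n₀)
  refine ⟨K, fun n => ?_⟩
  induction n using Nat.strong_induction_on with
  | _ n ih =>
  intro S hSE hS
  rcases lt_or_ge n n₀ with hn | hn
  · have h1 : S.card ≤ K := hK S hSE fun p hp q hq hpq =>
      (pow_le_pow_of_le_one hlam0.le hlam1.le hn.le).trans (hS p hp q hq hpq)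
    calc (S.card : ℝ) * x ^ n ≤ S.card * 1 := by
          gcongr
          exact pow_le_one₀ hx0.le hx1.le
      _ ≤ K := by rw [mul_one]; exact_mod_cast h1
  -- Pulling back by `f i` turns `lam ^ n`-separation into `lam ^ (n - k i)`-separation. The Moran
  -- equation then returns the same constant `K`.
  · let T : Fin m → Finset X := fun i => (S.preimage (f i) (hinj i).injOn).filter (· ∈ E)
    have hTcard : ∀ i, ((T i).card : ℝ) * x ^ n ≤ K * x ^ k i := by
      intro i
      have h1 := ih (n - k i) (by have := hk i; have := hkn i; omega) (T i)
        (fun p hp => by simpa using (Finset.mem_filter.1 hp).2) (by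
          intro p hp q hq hpq
          have hp' : f i p ∈ S := by simpa using (Finset.mem_filter.1 hp).1
          have hq' : f i q ∈ S := by simpa using (Finset.mem_filter.1 hq).1
          have h2 := hS _ hp' _ hq' ((hinj i).ne hpq)
          rw [hf, ← Nat.add_sub_cancel' ((hkn i).trans hn), pow_add] at h2
          exact le_of_mul_le_mul_left h2 (pow_pos hlam0 _))
      calc ((T i).card : ℝ) * x ^ n = (T i).card * x ^ (n - k i) * x ^ k i := by
            rw [mul_assoc, ← pow_add, Nat.sub_add_cancel ((hkn i).trans hn)]
        _ ≤ K * x ^ k i := by gcongr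
    have hsub : S ⊆ Finset.univ.biUnion fun i => (T i).image (f i) := by
      intro p hp
      obtain ⟨i, z, hz, rfl⟩ := Set.mem_iUnion.1 (hcov (hSE hp))
      refine Finset.mem_biUnion.2 ⟨i, Finset.mem_univ _, Finset.mem_image_of_mem _ ?_⟩
      exact Finset.mem_filter.2 ⟨by simpa using hp, hz⟩
    have hcard : S.card ≤ ∑ i, (T i).card :=
      (Finset.card_le_card hsub).trans (Finset.card_biUnion_le.trans
        (Finset.sum_le_sum fun i _ => Finset.card_image_le))
    calc (S.card : ℝ) * x ^ n ≤ (∑ i, ((T i).card : ℝ)) * x ^ n := by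
          gcongr
          exact_mod_cast hcard
      _ = ∑ i, ((T i).card : ℝ) * x ^ n := Finset.sum_mul _ _ _
      _ ≤ ∑ i, K * x ^ k i := Finset.sum_le_sum fun i _ => hTcard i
      _ = K := by rw [← Finset.mul_sum, hx, mul_one]

/-- Finitely many pairwise disjoint compact sets are uniformly separated. -/
theorem exists_pos_le_dist_of_disjoint {X : Type*} [MetricSpace X] {m : ℕ} {A : Fin m → Set X}
    (hA : ∀ i, IsCompact (A i)) (hd : ∀ i j, i ≠ j → Disjoint (A i) (A j)) :
    ∃ δ : ℝ, 0 < δ ∧ ∀ i j, i ≠ j → ∀ p ∈ A i, ∀ q ∈ A j, δ ≤ dist p q := by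
  have hpair : ∀ ij : Fin m × Fin m, ∃ δ : ℝ, 0 < δ ∧
      (ij.1 ≠ ij.2 → ∀ p ∈ A ij.1, ∀ q ∈ A ij.2, δ ≤ dist p q) := by
    rintro ⟨i, j⟩
    by_cases hij : i = j
    · exact ⟨1, one_pos, fun h => absurd hij h⟩
    · obtain ⟨r, hr, h⟩ :=
        Metric.exists_pos_forall_lt_edist (hA i) (hA j).isClosed (hd i j hij)
      refine ⟨r, by exact_mod_cast hr, fun _ p hp q hq => ?_⟩
      have h1 := h p hp q hq
      rw [edist_nndist] at h1
      have h2 : r < nndist p q := by exact_mod_cast h1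
      rw [dist_nndist]
      exact_mod_cast h2.le
  choose δ hδ hsep using hpair
  -- Choosing `ε` close to `0` avoids a minimum over a possibly empty index set.
  have hev : ∀ᶠ ε : ℝ in nhdsWithin 0 (Set.Ioi 0), ∀ ij, ε ∈ Set.Ioo 0 (δ ij) :=
    Filter.eventually_all.2 fun ij => Ioo_mem_nhdsGT (hδ ij)
  obtain ⟨ε, h, hε⟩ := (hev.and self_mem_nhdsWithin).exists
  exact ⟨ε, hε, fun i j hij p hp q hq => (h (i, j)).2.le.trans (hsep (i, j) hij p hp q hq)⟩

/-- A dust-like self-similar set has large `lam ^ n`-separated subsets. -/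
theorem exists_isSep_le_card_mul_pow {X : Type*} [MetricSpace X] {m : ℕ} {E : Set X}
    (hne : E.Nonempty) {lam x δ : ℝ} (hlam0 : 0 < lam) (hlam1 : lam < 1) (hx0 : 0 < x)
    (hx1 : x < 1) (hδ : 0 < δ) (k : Fin m → ℕ) (hk : ∀ i, 0 < k i) (hx : ∑ i, x ^ k i = 1)
    (f : Fin m → X → X) (hf : ∀ i p q, dist (f i p) (f i q) = lam ^ k i * dist p q)
    (hmaps : ∀ i, f i '' E ⊆ E)
    (hsep : ∀ i j, i ≠ j → ∀ p ∈ f i '' E, ∀ q ∈ f j '' E, δ ≤ dist p q) :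
    ∃ c : ℝ, 0 < c ∧ ∀ n : ℕ, ∃ S : Finset X, (S : Set X) ⊆ E ∧ IsSep (lam ^ n) S ∧
      c ≤ S.card * x ^ n := by
  classical
  have hinj : ∀ i, Function.Injective (f i) := by
    intro i p q hpq
    have h := hf i p q
    rw [hpq, dist_self] at h
    exact dist_eq_zero.1 ((mul_eq_zero.1 h.symm).resolve_left (pow_pos hlam0 _).ne')
  -- For `n ≥ n₁`, points in different pieces are automatically `lam ^ n`-separated.
  obtain ⟨n₁, hn₁⟩ := exists_pow_lt_of_lt_one hδ hlam1
  set n₀ := n₁ + ∑ i, k i with hn₀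
  have hkn : ∀ i, k i ≤ n₀ := fun i =>
    (Finset.single_le_sum (f := k) (fun _ _ => Nat.zero_le _) (Finset.mem_univ i)).trans
      (Nat.le_add_left _ _)
  -- With this constant a single point suffices for `n < n₀`.
  refine ⟨x ^ n₀, pow_pos hx0 _, fun n => ?_⟩
  induction n using Nat.strong_induction_on with
  | _ n ih =>
  rcases lt_or_ge n n₀ with hn | hn
  · obtain ⟨p, hp⟩ := hne
    refine ⟨{p}, by simpa using hp, ?_, ?_⟩
    · intro y hy z hz hyz
      simp only [Finset.mem_singleton] at hy hz
      exact absurd (hy.trans hz.symm) hyz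
    · simpa using pow_le_pow_of_le_one hx0.le hx1.le hn.le
  · have hlt : ∀ i, n - k i < n := fun i => by have := hk i; have := hkn i; omega
    choose T hTE hT hTcard using fun i => ih (n - k i) (hlt i)
    have hmem : ∀ i, ∀ p ∈ (T i).image (f i), p ∈ f i '' E := by
      intro i p hp
      obtain ⟨z, hz, rfl⟩ := Finset.mem_image.1 hp
      exact ⟨z, hTE i hz, rfl⟩
    have hdisj : ∀ i j, i ≠ j → Disjoint ((T i).image (f i)) ((T j).image (f j)) := by
      intro i j hij
      rw [Finset.disjoint_left]
      intro p hp hq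
      have h1 := hsep i j hij p (hmem i p hp) p (hmem j p hq)
      rw [dist_self] at h1
      linarith
    refine ⟨Finset.univ.biUnion fun i => (T i).image (f i), ?_, ?_, ?_⟩
    · intro p hp
      obtain ⟨i, -, hi⟩ := Finset.mem_biUnion.1 (Finset.mem_coe.1 hp)
      exact hmaps i (hmem i p hi)
    · intro p hp q hq hpq
      obtain ⟨i, -, hi⟩ := Finset.mem_biUnion.1 hp
      obtain ⟨j, -, hj⟩ := Finset.mem_biUnion.1 hq
      by_cases hij : i = j
      · subst hij
        obtain ⟨y, hy, rfl⟩ := Finset.mem_image.1 hi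
        obtain ⟨z, hz, rfl⟩ := Finset.mem_image.1 hj
        have h1 := hT i y hy z hz fun h => hpq (congrArg (f i) h)
        rw [hf, ← Nat.add_sub_cancel' ((hkn i).trans hn), pow_add]
        exact mul_le_mul_of_nonneg_left h1 (pow_pos hlam0 _).le
      · calc lam ^ n ≤ lam ^ n₁ := pow_le_pow_of_le_one hlam0.le hlam1.le (by omega)
          _ ≤ δ := hn₁.le
          _ ≤ dist p q := hsep i j hij p (hmem i p hi) q (hmem j q hj)
    · rw [Finset.card_biUnion fun i _ j _ hij => hdisj i j hij]
      push_cast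
      rw [Finset.sum_mul]
      calc x ^ n₀ = ∑ i, x ^ n₀ * x ^ k i := by rw [← Finset.mul_sum, hx, mul_one]
        _ ≤ ∑ i, (((T i).image (f i)).card : ℝ) * x ^ n := by
          refine Finset.sum_le_sum fun i _ => ?_
          rw [Finset.card_image_of_injective _ (hinj i)]
          calc x ^ n₀ * x ^ k i ≤ (T i).card * x ^ (n - k i) * x ^ k i :=
                mul_le_mul_of_nonneg_right (hTcard i) (pow_pos hx0 _).le
            _ = (T i).card * x ^ n := by
              rw [mul_assoc, ← pow_add, Nat.sub_add_cancel ((hkn i).trans hn)]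

theorem dist_simMap {N : ℕ} {r : ℝ} (hr : 0 ≤ r)
    (R : EuclideanSpace ℝ (Fin N) ≃ₗᵢ[ℝ] EuclideanSpace ℝ (Fin N))
    (v p q : EuclideanSpace ℝ (Fin N)) :
    dist (simMap r R v p) (simMap r R v q) = r * dist p q := by
  rw [simMap, simMap, dist_smul₀, R.dist_map, dist_add_right, Real.norm_of_nonneg hr]

/-- A bi-Lipschitz image does not lower the exponential growth rate of separated sets. -/
theorem le_of_dist_bounds {N m m' : ℕ} {lam x y : ℝ} (hlam0 : 0 < lam) (hlam1 : lam < 1)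
    (hx0 : 0 < x) (hx1 : x < 1) (hy0 : 0 < y) (hy1 : y < 1)
    (k : Fin m → ℕ) (hk : ∀ i, 0 < k i) (hx : ∑ i, x ^ k i = 1)
    (l : Fin m' → ℕ) (hl : ∀ i, 0 < l i) (hy : ∑ i, y ^ l i = 1)
    {E F : Set (EuclideanSpace ℝ (Fin N))}
    (hE : E ∈ dustLikeSets N fun i => lam ^ k i) (hF : F ∈ dustLikeSets N fun i => lam ^ l i)
    (ψ : E → F) {C : ℝ} (hC : 0 < C)
    (hinj : Function.Injective ψ) (hψ : ∀ p q : E, dist (ψ p) (ψ q) ≥ C⁻¹ * dist p q) :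
    y ≤ x := by
  classical
  obtain ⟨hEne, hEc, R, v, hEeq, hEd⟩ := hE
  obtain ⟨-, hFc, R', v', hFeq, -⟩ := hF
  have hfE : ∀ i p q, dist (simMap (lam ^ k i) (R i) (v i) p) (simMap (lam ^ k i) (R i) (v i) q)
      = lam ^ k i * dist p q := fun i p q => dist_simMap (pow_pos hlam0 _).le _ _ _ _
  obtain ⟨δ, hδ, hsep⟩ := exists_pos_le_dist_of_disjoint
    (A := fun i => simMap (lam ^ k i) (R i) (v i) '' E)
    (fun i => hEc.image (LipschitzWith.of_dist_le_mul (K := ⟨lam ^ k i, (pow_pos hlam0 _).le⟩)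
      fun p q => (hfE i p q).le).continuous)
    (fun i j hij => Set.disjoint_iff_inter_eq_empty.2 (hEd i j hij))
  obtain ⟨c, hc, hlow⟩ := exists_isSep_le_card_mul_pow hEne hlam0 hlam1 hx0 hx1 hδ k hk hx _ hfE
    (fun i => (Set.subset_iUnion (fun i => simMap (lam ^ k i) (R i) (v i) '' E) i).trans hEeq.ge)
    hsep
  obtain ⟨K, hup⟩ := exists_card_mul_pow_le hFc hlam0 hlam1 hy0 hy1 l hl hy
    (fun i => simMap (lam ^ l i) (R' i) (v' i))
    (fun i p q => dist_simMap (pow_pos hlam0 _).le _ _ _ _) hFeq.le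
  -- The shift `t` absorbs `C`: images of `lam ^ n`-separated sets are `lam ^ (n + t)`-separated.
  obtain ⟨t, ht⟩ := exists_pow_lt_of_lt_one (inv_pos.2 hC) hlam1
  by_contra! hxy
  have hbound : ∀ n : ℕ, (y / x) ^ n ≤ K / (c * y ^ t) := by
    intro n
    obtain ⟨S, hSE, hS, hcard⟩ := hlow n
    have hScard : (S.attach.image fun p : S => (ψ ⟨p, hSE p.2⟩ : EuclideanSpace ℝ (Fin N))).card
        = S.card := by
      rw [Finset.card_image_of_injective, Finset.card_attach]
      intro p q hpq
      exact Subtype.ext (Subtype.mk.inj (hinj (Subtype.ext hpq)))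
    have h1 := hup (n + t)
      (S.attach.image fun p : S => (ψ ⟨p, hSE p.2⟩ : EuclideanSpace ℝ (Fin N))) (by
        intro p hp
        obtain ⟨z, -, rfl⟩ := Finset.mem_image.1 (Finset.mem_coe.1 hp)
        exact (ψ _).2) (by
        intro p hp q hq hpq
        obtain ⟨w, -, rfl⟩ := Finset.mem_image.1 hp
        obtain ⟨z, -, rfl⟩ := Finset.mem_image.1 hq
        have h2 := hS w w.2 z z.2 fun h => hpq (by rw [Subtype.ext h])
        calc lam ^ (n + t) = lam ^ t * lam ^ n := by rw [pow_add, mul_comm]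
          _ ≤ C⁻¹ * dist (w : EuclideanSpace ℝ (Fin N)) z :=
            mul_le_mul ht.le h2 (pow_pos hlam0 _).le (inv_pos.2 hC).le
          _ ≤ _ := hψ ⟨w, hSE w.2⟩ ⟨z, hSE z.2⟩)
    rw [hScard] at h1
    have hxn := pow_pos hx0 n
    have hyt := pow_pos hy0 t
    have hyn := pow_pos hy0 n
    rw [div_pow, div_le_div_iff₀ hxn (by positivity)]
    calc y ^ n * (c * y ^ t) ≤ y ^ n * (S.card * x ^ n * y ^ t) := by gcongr
      _ = S.card * y ^ (n + t) * x ^ n := by rw [pow_add]; ring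
      _ ≤ K * x ^ n := by gcongr
  obtain ⟨n, hn⟩ := pow_unbounded_of_one_lt (K / (c * y ^ t)) ((one_lt_div hx0).2 hxy)
  exact absurd (hbound n) (not_le.2 hn)

/-- The Moran equation has a solution in `(0, 1)`. -/
theorem exists_sum_pow_eq_one {m : ℕ} (hm : 2 ≤ m) (k : Fin m → ℕ) (hk : ∀ i, 0 < k i) :
    ∃ x : ℝ, 0 < x ∧ x < 1 ∧ ∑ i, x ^ k i = 1 := by
  have hcont : ContinuousOn (fun x : ℝ => ∑ i, x ^ k i) (Set.Icc 0 1) := by fun_prop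
  have h0 : ∑ i, (0 : ℝ) ^ k i = 0 := Finset.sum_eq_zero fun i _ => zero_pow (hk i).ne'
  have h1 : ∑ i, (1 : ℝ) ^ k i = m := by simp
  have hm' : (1 : ℝ) < m := by exact_mod_cast hm
  obtain ⟨x, ⟨hx0, hx1⟩, hx⟩ := intermediate_value_Ioo zero_le_one hcont
    (show (1 : ℝ) ∈ Set.Ioo _ _ by
      rw [h0, h1]
      exact ⟨one_pos, hm'⟩)
  exact ⟨x, hx0, hx1, hx⟩

/-- Lipschitz equivalent dust-like sets have a common solution of their Moran equations. -/
theorem DustLipEquiv.exists_common_root {N m m' : ℕ} {lam : ℝ} (hlam0 : 0 < lam)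
    (hlam1 : lam < 1) (k : Fin m → ℕ) (hk : ∀ i, 0 < k i) (hm : 2 ≤ m)
    (l : Fin m' → ℕ) (hl : ∀ i, 0 < l i) (hm' : 2 ≤ m')
    (h : DustLipEquiv N (fun i => lam ^ k i) fun i => lam ^ l i) :
    ∃ x : ℝ, ∑ i, x ^ k i = 1 ∧ ∑ i, x ^ l i = 1 := by
  obtain ⟨x, hx0, hx1, hx⟩ := exists_sum_pow_eq_one hm k hk
  obtain ⟨y, hy0, hy1, hy⟩ := exists_sum_pow_eq_one hm' l hl
  obtain ⟨E, hE, F, hF, φ, hφ, C, hC, hdist⟩ := h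
  have hyx : y ≤ x := le_of_dist_bounds hlam0 hlam1 hx0 hx1 hy0 hy1 k hk hx l hl hy hE hF φ hC
    hφ.injective fun p q => (hdist p q).1
  let ψ := Equiv.ofBijective φ hφ
  have hxy : x ≤ y := le_of_dist_bounds hlam0 hlam1 hy0 hy1 hx0 hx1 l hl hy k hk hx hF hE ψ.symm
    hC ψ.symm.injective fun p q => by
      have h1 := (hdist (ψ.symm p) (ψ.symm q)).2
      have hp : φ (ψ.symm p) = p := ψ.apply_symm_apply p
      have hq : φ (ψ.symm q) = q := ψ.apply_symm_apply q
      rw [hp, hq] at h1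
      rwa [ge_iff_le, inv_mul_le_iff₀ hC]
  exact ⟨x, hx, le_antisymm hyx hxy ▸ hy⟩

/-- If `X ^ a + X ^ b + X ^ c - 1` shares a real root with `X ^ d + X ^ e - 1`, it is not
irreducible over `ℚ`: otherwise it would divide the latter over `ℤ`, and evaluating at `1` would
give `2 ∣ 1`. -/
theorem not_irreducible_of_common_root {a b c d e : ℕ} (ha : 0 < a) (hb : 0 < b) (hc : 0 < c)
    {x : ℝ} (hx : x ^ a + x ^ b + x ^ c = 1) (hx' : x ^ d + x ^ e = 1) :
    ¬ Irreducible (X ^ a + X ^ b + X ^ c - 1 : ℚ[X]) := by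
  intro hirr
  have hdvd : (X ^ a + X ^ b + X ^ c - 1 : ℚ[X]) ∣ X ^ d + X ^ e - 1 := by
    have h1 : aeval x (X ^ a + X ^ b + X ^ c - 1 : ℚ[X]) = 0 := by simp [hx]
    have h2 : aeval x (X ^ d + X ^ e - 1 : ℚ[X]) = 0 := by simp [hx']
    by_contra hnd
    -- A Bézout relation, evaluated at the common root, reads `0 = 1`.
    obtain ⟨u, w, huw⟩ := (hirr.coprime_iff_not_dvd).2 hnd
    have h3 := congrArg (aeval x) huw
    rw [map_add, map_mul, map_mul, h1, h2, mul_zero, mul_zero, add_zero, map_one] at h3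
    exact zero_ne_one h3
  have hprim : (X ^ a + X ^ b + X ^ c - 1 : ℤ[X]).IsPrimitive := by
    intro r hr
    obtain ⟨q, hq⟩ := hr
    -- The constant term is `-1`, so any constant divisor is a unit.
    have h0 := congrArg (eval 0) hq
    simp only [eval_sub, eval_add, eval_pow, eval_X, eval_one, eval_mul, eval_C,
      zero_pow ha.ne', zero_pow hb.ne', zero_pow hc.ne'] at h0
    exact isUnit_of_dvd_unit (Dvd.intro _ h0.symm) (by norm_num)
  have hdvdZ : (X ^ a + X ^ b + X ^ c - 1 : ℤ[X]) ∣ X ^ d + X ^ e - 1 := by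
    rw [IsPrimitive.Int.dvd_iff_map_cast_dvd_map_cast _ _ hprim]
    simpa using hdvd
  have h1 := eval_dvd (x := 1) hdvdZ
  norm_num at h1

end CantorLip

open Polynomial in
theorem mainTheorem1 (N : ℕ) (lam : ℝ) (hlam0 : 0 < lam) (hlam1 : lam < 1)
    (a b c d e : ℕ) (ha : 0 < a) (hb : 0 < b) (hc : 0 < c) (hd : 0 < d) (he : 0 < e)
    (hα : CantorLip.IsContractionVector N ![lam ^ a, lam ^ b, lam ^ c])
    (hβ : CantorLip.IsContractionVector N ![lam ^ d, lam ^ e])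
    (h : CantorLip.DustLipEquiv N ![lam ^ a, lam ^ b, lam ^ c] ![lam ^ d, lam ^ e]) :
    ∃ p q : Polynomial ℚ, 0 < p.natDegree ∧ 0 < q.natDegree ∧
      (Polynomial.X ^ a + Polynomial.X ^ b + Polynomial.X ^ c - 1 : Polynomial ℚ) = p * q := by
  have hα' : ![lam ^ a, lam ^ b, lam ^ c] = fun i => lam ^ (![a, b, c] i) := by
    funext i; fin_cases i <;> rfl
  have hβ' : ![lam ^ d, lam ^ e] = fun i => lam ^ (![d, e] i) := by
    funext i; fin_cases i <;> rfl
  rw [hα', hβ'] at h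
  obtain ⟨x, hx, hx'⟩ := h.exists_common_root hlam0 hlam1 _
    (fun i => by fin_cases i <;> assumption) (by norm_num) _
    (fun i => by fin_cases i <;> assumption) le_rfl
  simp only [Fin.sum_univ_succ, Fin.sum_univ_zero] at hx hx'
  have hirr := CantorLip.not_irreducible_of_common_root (d := d) (e := e) ha hb hc (x := x)
    (by simpa [add_assoc] using hx) (by simpa using hx')
  have hroot : aeval x (X ^ a + X ^ b + X ^ c - 1 : ℚ[X]) = 0 := by
    simpa [add_assoc, sub_eq_zero] using hx
  have hne : (X ^ a + X ^ b + X ^ c - 1 : ℚ[X]) ≠ 0 := by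
    intro h0
    have h1 := congrArg (eval 1) h0
    norm_num at h1
  have hnu : ¬ IsUnit (X ^ a + X ^ b + X ^ c - 1 : ℚ[X]) := fun hu =>
    (hu.map (aeval x)).ne_zero hroot
  rw [irreducible_iff, not_and] at hirr
  have hfac := hirr hnu
  push Not at hfac
  obtain ⟨p, q, hpq, hp, hq⟩ := hfac
  have hp0 : p ≠ 0 := fun h0 => hne (by rw [hpq, h0, zero_mul])
  have hq0 : q ≠ 0 := fun h0 => hne (by rw [hpq, h0, mul_zero])
  refine ⟨p, q, ?_, ?_, hpq⟩
  · exact natDegree_pos_iff_degree_pos.2 (degree_pos_of_ne_zero_of_nonunit hp0 hp)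
  · exact natDegree_pos_iff_degree_pos.2 (degree_pos_of_ne_zero_of_nonunit hq0 hq)
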